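/- **Setting.** Let $A\in\mathbb R[t]^{n\times n}$ have degree at most $d$. Let $\Delta A\in\mathbb R[t]^{n\times n}$ (degree at most $d$), $F\in\mathbb R[t]^{n\times n}$ (degree at most $e$) and $h\in\mathbb R[t]$ (degree at most $m$) range over prescribed affine families, each a fixed element plus a real linear combination of finitely many fixed elements, and let $x\in\mathbb R^{N}$ be the vector of all the parameters. Let $\mathcal N_h\in\mathbb R^{1\times(m+1)}$ be a fixed row vector and, with $\operatorname{vec}$ the vector of all coefficients (padded to degree $\max((n-1)d,\,e+m)$ for the matrix $\operatorname{Adj}(A+\Delta A)-Fh$ and to degree $m$ for $h$), consider $$\min_x \|\Delta A\|_F^2\quad\text{subject to}\quad \operatorname{Adj}(A+\Delta A)=F h,\qquad \mathcal N_h \operatorname{vec}(h)=1 .$$ Here $\operatorname{Adj}$ is the adjugate and $\|\cdot\|_F^2$ is the sum of the squares of all coefficients. Write the constraints as $c(x)=0$ with $$c(x)=\begin{pmatrix}\operatorname{vec}(\operatorname{Adj}(A+\Delta A)-Fh)\\ \mathcal N_h\operatorname{vec}(h)-1\end{pmatrix},$$ and let $L(z)=\|\Delta A\|_F^2+\lambda^Tc(x)$,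 $z=(x,\lambda)\in\mathbb R^\ell$, be the Lagrangian, $J$ the Jacobian matrix of $c$ with respect to $x$, $H=\nabla^2L$ the Hessian of $L$ with respect to $z$, and $Z^\star=\{z:\nabla L(z)=0\}$. All norms are Euclidean. The Levenberg–Marquardt (LM) iteration for $\nabla L=0$ from $z^{(0)}$ with $\nu_k=\|\nabla L(z^{(k)})\|_2$ is $z^{(k+1)}=z^{(k)}+\Delta z^{(k)}$, where $$\bigl(H(z^{(k)})^TH(z^{(k)})+\nu_kI\bigr)\Delta z^{(k)}=-H(z^{(k)})^T\nabla L(z^{(k)}),$$ and $\Delta z^{(k)}=0$ if $\nabla L(z^{(k)})=0$. **Corollary.** Let $z^\star=(x^\star,\lambda^\star)$ satisfy $\nabla L(z^\star)=0$ and the second-order sufficiency condition $$y^T\nabla^2_{xx}L(z^\star)\,y>0\qquad\text{for all } y\ne0 \text{ with } J(x^\star)y=0 .$$ Then there are $r>0$ and $C>0$ such that for every initial guess $z^{(0)}$ with $\|z^{(0)}-z^\star\|<r$ the LM sequence $(z^{(k)})$ is well defined and unique, and it converges quadratically to a solution of $\nabla L=0$: there is $\hat z\in Z^\star$ with $z^{(k)}\to\hat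 z$ and, for all $k\ge0$, $$\|z^{(k+1)}-\hat z\|\le C\,\|z^{(k)}-\hat z\|^2\qquad\text{and}\qquad \operatorname{dist}(z^{(k+1)},Z^\star)\le C\,\operatorname{dist}(z^{(k)},Z^\star)^2 .$$ -/

import Mathlib

open Polynomial

noncomputable section

namespace ApproxSNF

/-- The member `v₀ + ∑ pᵢ vᵢ` of an affine family, with parameter vector `p`. -/
def affineCombo {k : ℕ} {V : Type*} [AddCommGroup V] [Module ℝ V]
    (v₀ : V) (v : Fin k → V) (p : Fin k → ℝ) : V :=
  v₀ + ∑ i, p i • v i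

/-- An instance of the approximate Smith normal form optimization problem

`min ‖ΔA‖_F²  subject to  Adj (A + ΔA) = F h,  N_h vec(h) = 1`.

`A` is an `n × n` real matrix polynomial of degree at most `d`; the perturbation `ΔA`
(degree at most `d`), the matrix polynomial `F` (degree at most `e`) and the polynomial `h`
(degree at most `m`) range over prescribed affine families with `a`, `b` and `c` real
parameters (for instance all of them, with the coefficients as the parameters); `normRow` is
the row vector `N_h` of the normalization of `h`. -/
structure Problem where
  /-- size of the matrix -/
  n : ℕ
  /-- degree bound for `A` and `ΔA` -/
  d : ℕ
  /-- degree bound for the cofactor `F` -/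
  e : ℕ
  /-- degree bound for the divisor `h` -/
  m : ℕ
  /-- number of parameters of `ΔA` -/
  a : ℕ
  /-- number of parameters of `F` -/
  b : ℕ
  /-- number of parameters of `h` -/
  c : ℕ
  A : Matrix (Fin n) (Fin n) ℝ[X]
  A_deg : ∀ i j, (A i j).natDegree ≤ d
  pert₀ : Matrix (Fin n) (Fin n) ℝ[X]
  pert : Fin a → Matrix (Fin n) (Fin n) ℝ[X]
  pert₀_deg : ∀ i j, (pert₀ i j).natDegree ≤ d
  pert_deg : ∀ s i j, (pert s i j).natDegree ≤ d
  cof₀ : Matrix (Fin n) (Fin n) ℝ[X]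
  cof : Fin b → Matrix (Fin n) (Fin n) ℝ[X]
  cof₀_deg : ∀ i j, (cof₀ i j).natDegree ≤ e
  cof_deg : ∀ s i j, (cof s i j).natDegree ≤ e
  dvs₀ : ℝ[X]
  dvs : Fin c → ℝ[X]
  dvs₀_deg : dvs₀.natDegree ≤ m
  dvs_deg : ∀ s, (dvs s).natDegree ≤ m
  normRow : Fin (m + 1) → ℝ

namespace Problem

variable (P : Problem)

/-- A degree bound for the entries of `Adj (A + ΔA) - F h`. -/
def residualDeg : ℕ := max ((P.n - 1) * P.d) (P.e + P.m)

/-- Indices of the primal variables: the parameters of `ΔA`, `F` and `h`. -/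
abbrev VarIdx : Type := Fin P.a ⊕ Fin P.b ⊕ Fin P.c

/-- Indices of the scalar constraints: one for each coefficient of each entry of
`Adj (A + ΔA) - F h`, and one for the normalization of `h`. -/
abbrev ConIdx : Type := (Fin P.n × Fin P.n × Fin (P.residualDeg + 1)) ⊕ Unit

/-- The space of the primal variables `x`, with the Euclidean norm. -/
abbrev Var : Type := EuclideanSpace ℝ P.VarIdx

/-- The space of the Lagrange multipliers `λ` (and of the constraint values). -/
abbrev Mult : Type := EuclideanSpace ℝ P.ConIdx

/-- The space of the vectors `z = (x, λ)`, with the Euclidean norm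
`‖z‖² = ‖x‖² + ‖λ‖²`. -/
abbrev Pt : Type := WithLp 2 (P.Var × P.Mult)

/-- `ΔA` as a function of `x`. -/
def deltaA (x : P.Var) : Matrix (Fin P.n) (Fin P.n) ℝ[X] :=
  affineCombo P.pert₀ P.pert fun s => x (Sum.inl s)

/-- `F` as a function of `x`. -/
def cofactor (x : P.Var) : Matrix (Fin P.n) (Fin P.n) ℝ[X] :=
  affineCombo P.cof₀ P.cof fun s => x (Sum.inr (Sum.inl s))

/-- `h` as a function of `x`. -/
def divisor (x : P.Var) : ℝ[X] :=
  affineCombo P.dvs₀ P.dvs fun s => x (Sum.inr (Sum.inr s))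

/-- The objective `‖ΔA‖_F²`, the sum of the squares of all coefficients. -/
def objective (x : P.Var) : ℝ :=
  ∑ i, ∑ j, ∑ k ∈ Finset.range (P.d + 1), ((P.deltaA x i j).coeff k) ^ 2

/-- The constraint function: the vector of all coefficients of `Adj (A + ΔA) - F h`, together
with `N_h vec(h) - 1`. -/
def constraint (x : P.Var) : P.Mult :=
  WithLp.toLp 2 <| Sum.elim
    (fun idx => ((P.A + P.deltaA x).adjugate idx.1 idx.2.1
      - P.cofactor x idx.1 idx.2.1 * P.divisor x).coeff idx.2.2)
    (fun _ => (∑ k, P.normRow k * (P.divisor x).coeff k) - 1)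

/-- The Lagrangian `L(x, λ) = ‖ΔA‖_F² + λᵀ (constraints)`. -/
def lagrangian (x : P.Var) (l : P.Mult) : ℝ :=
  P.objective x + inner ℝ l (P.constraint x)

/-- The gradient `∇L` with respect to the full vector `z = (x, λ)`. -/
def gradL (z : P.Pt) : P.Pt :=
  gradient (fun w : P.Pt => P.lagrangian w.fst w.snd) z

/-- The Hessian `H = ∇²L` with respect to the full vector `z`. -/
def hessL (z : P.Pt) : P.Pt →L[ℝ] P.Pt :=
  fderiv ℝ P.gradL z

/-- The Hessian `∇²ₓₓ L` of the Lagrangian with respect to the primal variables. -/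
def hessXX (z : P.Pt) : P.Var →L[ℝ] P.Var :=
  fderiv ℝ (gradient fun x : P.Var => P.lagrangian x z.snd) z.fst

/-- The Jacobian `J` of all the constraints with respect to the primal variables. -/
def jac (z : P.Pt) : P.Var →L[ℝ] P.Mult :=
  fderiv ℝ P.constraint z.fst

/-- The first-order (KKT) condition `∇L(z) = 0`. -/
def FirstOrder (z : P.Pt) : Prop :=
  P.gradL z = 0

/-- The second-order sufficiency condition: the Hessian of `L` with respect to `x` is positive
definite on the kernel of the Jacobian of the constraints. -/
def SecondOrderSufficient (z : P.Pt) : Prop :=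
  ∀ y : P.Var, P.jac z y = 0 → y ≠ 0 → 0 < inner ℝ y (P.hessXX z y)

/-- `z 0, z 1, …` is the sequence of Levenberg-Marquardt iterates for `∇L = 0` started at `z₀`:
`(HᵀH + ν_k I) (z_{k+1} - z_k) = -Hᵀ ∇L(z_k)` with `H = ∇²L(z_k)` and `ν_k = ‖∇L(z_k)‖₂`.
The method stops once `∇L(z_k) = 0`; the sequence is then constant. -/
def IsLMSequence (z₀ : P.Pt) (z : ℕ → P.Pt) : Prop :=
  z 0 = z₀ ∧ ∀ k,
    (P.gradL (z k) = 0 → z (k + 1) = z k) ∧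
    ContinuousLinearMap.adjoint (P.hessL (z k)) (P.hessL (z k) (z (k + 1) - z k))
        + ‖P.gradL (z k)‖ • (z (k + 1) - z k)
      = -ContinuousLinearMap.adjoint (P.hessL (z k)) (P.gradL (z k))

end Problem

end ApproxSNF

end

/-! Without any constraint qualification, the multiplier is determined only up to the kernel of
`Jᵀ`. Let `K` be the space of all `(0, μ)` with `Jᵀ μ = 0` at `zs` (`multKer`). The Lagrangian is
affine in the multiplier, so `gradL` vanishes on all of `zs + K`. If `H (y, μ) = 0` at `zs`, then `J
y = 0` and `∇²ₓₓL y + Jᵀ μ = 0`; pairing the second equation with `y` and using second-order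
sufficiency gives `y = 0`, hence `(y, μ) ∈ K` (`mem_multKer_of_hessL_eq_zero`).

It remains to treat a C² map `F` that vanishes on `zs + K` and whose derivative at `zs` is injective
modulo `K`. Let `p` be the projection of `z` onto `zs + K`, and `δ = ‖z - p‖`. Near `zs` the
derivative is bounded below on `Kᗮ` and is `O(δ)` on `K`, and `‖F z‖` is comparable to `δ`
(`exists_local_estimates`). Hence the damping is of order `δ`, and testing the normal equations
shows that the next iterate is within `O(δ²)` of `p` (`exists_norm_le_of_normal_eq`). The distances
to `zs + K` thus decrease quadratically and the projections form a Cauchy sequence, whose limit is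
the required solution (`exists_quadratic_convergence`). -/

noncomputable section

namespace ApproxSNF

/-! ### Levenberg–Marquardt steps near an affine space of zeros. -/

section LevenbergMarquardt

open Metric Filter Topology

variable {E : Type*} [NormedAddCommGroup E] [InnerProductSpace ℝ E] [FiniteDimensional ℝ E]

/-- The projection of `z` onto the affine subspace `zs + K`. -/
def affProj (zs : E) (K : Submodule ℝ E) (z : E) : E := zs + K.starProjection (z - zs)

/-- `z'` is a Levenberg-Marquardt step for `F = 0` from `z`, with damping parameter `‖F z‖`. -/
def IsLMStep (F : E → E) (z z' : E) : Prop :=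
  (F z = 0 → z' = z) ∧
    ContinuousLinearMap.adjoint (fderiv ℝ F z) (fderiv ℝ F z (z' - z)) + ‖F z‖ • (z' - z)
      = -ContinuousLinearMap.adjoint (fderiv ℝ F z) (F z)

lemma norm_le_of_sq_le {B D h : ℝ} (hB : 0 ≤ B) (hD : 0 ≤ D)
    (H : h ^ 2 ≤ B * D * h + B * D ^ 2) : h ≤ (B + 1) * D := by
  by_contra! hlt
  have h0 : 0 ≤ (B + 1) * D := by positivity
  nlinarith [mul_nonneg hB hD]

/-- A solution of the damped normal equations `(TᵀT + ν) w = -Tᵀ q + ν u` is of second order in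
`δ = ‖u‖` when `T` is of order `δ` on `K` and bounded below on `Kᗮ`. -/
lemma exists_norm_le_of_normal_eq (K : Submodule ℝ E) {Λ σ a : ℝ} (hΛ : 0 < Λ) (hσ : 0 < σ)
    (ha : 0 < a) :
    ∃ C > 0, ∀ (T : E →L[ℝ] E) (w u q : E) (δ ν : ℝ), 0 < δ → δ ≤ 1 → u ∈ Kᗮ → ‖u‖ ≤ δ →
      ‖q‖ ≤ Λ * δ ^ 2 → (∀ k ∈ K, ‖T k‖ ≤ Λ * δ * ‖k‖) → (∀ v ∈ Kᗮ, σ * ‖v‖ ≤ ‖T v‖) →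
      a * δ ≤ ν → ν ≤ Λ * δ →
      ContinuousLinearMap.adjoint T (T w) + ν • w
        = -ContinuousLinearMap.adjoint T q + ν • u → ‖w‖ ≤ C * δ ^ 2 := by
  set A₁ := (Λ + Λ ^ 2) / a with hA₁
  set A₂ := (1 + Λ * A₁) / σ with hA₂
  set B := Λ + Λ * A₂ with hB
  have hA₁0 : 0 < A₁ := by positivity
  have hA₂0 : 0 < A₂ := by positivity
  have hB0 : 0 < B := by positivity
  refine ⟨(A₁ + A₂) * (B + 2), by positivity, ?_⟩
  intro T w u q δ ν hδ hδ1 hu hun hq hK hKo haν hνΛ heq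
  set wk := K.starProjection w with hwk
  have hwkK : wk ∈ K := K.starProjection_apply_mem w
  set wp := w - wk with hwp
  have hwpK : wp ∈ Kᗮ := Submodule.sub_starProjection_mem_orthogonal w
  have hw : w = wk + wp := by simp [hwp]
  have hort : inner ℝ wp wk = (0 : ℝ) := Submodule.inner_left_of_mem_orthogonal hwkK hwpK
  have huk : inner ℝ u wk = (0 : ℝ) := Submodule.inner_left_of_mem_orthogonal hwkK hu
  -- Weak form of the normal equations, tested below with `y = wk` and `y = w`.
  have key : ∀ y : E, inner ℝ (T w) (T y) + ν * inner ℝ w y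
      = -inner ℝ q (T y) + ν * inner ℝ u y := by
    intro y
    have := congrArg (fun t => inner ℝ t y) heq
    simpa [inner_add_left, inner_smul_left, ContinuousLinearMap.adjoint_inner_left] using this
  have hν : 0 < ν := lt_of_lt_of_le (by positivity) haν
  have h0 : 0 ≤ ‖T w‖ := norm_nonneg _
  have hk0 : 0 ≤ ‖wk‖ := norm_nonneg _
  have hp0 : 0 ≤ ‖wp‖ := norm_nonneg _
  have hTk := hK wk hwkK
  -- Testing with `wk` kills the `u` term. The factor `δ` in the bound for `T` on `K` then cancels
  -- the one in `a * δ ≤ ν`.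
  have hkbound : ‖wk‖ ≤ A₁ * (‖T w‖ + δ ^ 2) := by
    have e1 := key wk
    have e2 : inner ℝ w wk = ‖wk‖ ^ 2 := by
      rw [hw, inner_add_left, hort, real_inner_self_eq_norm_sq, add_zero]
    rw [huk, e2] at e1
    have i1 : -(‖T w‖ * ‖T wk‖) ≤ inner ℝ (T w) (T wk) :=
      neg_le_of_abs_le (abs_real_inner_le_norm _ _)
    have i2 : -(‖q‖ * ‖T wk‖) ≤ inner ℝ q (T wk) :=
      neg_le_of_abs_le (abs_real_inner_le_norm _ _)
    have i3 : ν * ‖wk‖ ^ 2 ≤ (‖T w‖ + ‖q‖) * ‖T wk‖ := by nlinarith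
    have i4 : ν * ‖wk‖ ^ 2 ≤ (‖T w‖ + Λ * δ ^ 2) * (Λ * δ * ‖wk‖) :=
      i3.trans (by gcongr)
    rcases hk0.eq_or_lt with hz | hpos
    · rw [← hz]; positivity
    have i5 : a * δ * ‖wk‖ ≤ (‖T w‖ + Λ * δ ^ 2) * (Λ * δ) := by
      have : ν * ‖wk‖ ≤ (‖T w‖ + Λ * δ ^ 2) * (Λ * δ) := by
        refine le_of_mul_le_mul_right ?_ hpos
        linarith
      exact le_trans (by gcongr) this
    have i6 : a * ‖wk‖ ≤ (‖T w‖ + Λ * δ ^ 2) * Λ := by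
      refine le_of_mul_le_mul_right ?_ hδ
      linarith
    rw [hA₁, div_mul_eq_mul_div, le_div_iff₀ ha]
    have j1 : 0 ≤ Λ ^ 2 * ‖T w‖ := by positivity
    have j2 : 0 ≤ Λ * δ ^ 2 := by positivity
    linarith
  have hpbound : ‖wp‖ ≤ A₂ * (‖T w‖ + δ ^ 2) := by
    have i1 := hKo wp hwpK
    have i2 : ‖T wp‖ ≤ ‖T w‖ + ‖T wk‖ := by
      rw [hwp, map_sub]; exact norm_sub_le _ _
    have i3 : Λ * δ * ‖wk‖ ≤ Λ * 1 * (A₁ * (‖T w‖ + δ ^ 2)) := by gcongr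
    rw [hA₂, div_mul_eq_mul_div, le_div_iff₀ hσ]
    have j2 : 0 ≤ δ ^ 2 := by positivity
    linarith
  -- Testing with `w`: since `u ⊥ K`, only `wp` meets `u`, and `ν * ‖u‖` is already `O(δ²)`. This
  -- leaves a quadratic inequality for `‖T w‖`.
  have hTw : ‖T w‖ ≤ (B + 1) * δ ^ 2 := by
    refine norm_le_of_sq_le hB0.le (by positivity) ?_
    have e1 := key w
    rw [real_inner_self_eq_norm_sq, real_inner_self_eq_norm_sq] at e1
    have e2 : inner ℝ u w = inner ℝ u wp := by
      conv_lhs => rw [hw, inner_add_right, huk, zero_add]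
    rw [e2] at e1
    have i2 : -(‖q‖ * ‖T w‖) ≤ inner ℝ q (T w) :=
      neg_le_of_abs_le (abs_real_inner_le_norm _ _)
    have i3 : inner ℝ u wp ≤ ‖u‖ * ‖wp‖ := real_inner_le_norm _ _
    have i4 : inner ℝ u wp ≤ δ * (A₂ * (‖T w‖ + δ ^ 2)) := i3.trans (by gcongr)
    have i5 : ν * inner ℝ u wp ≤ Λ * δ * (δ * (A₂ * (‖T w‖ + δ ^ 2))) :=
      (mul_le_mul_of_nonneg_left i4 hν.le).trans (by gcongr)
    have i6 : ‖q‖ * ‖T w‖ ≤ Λ * δ ^ 2 * ‖T w‖ := by gcongr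
    have i7 : 0 ≤ ν * ‖w‖ ^ 2 := by positivity
    have i8 : 0 ≤ Λ * (δ ^ 2) ^ 2 := by positivity
    rw [hB]
    nlinarith
  have hww : ‖w‖ ≤ ‖wk‖ + ‖wp‖ := by
    conv_lhs => rw [hw]
    exact norm_add_le _ _
  calc ‖w‖ ≤ (A₁ + A₂) * (‖T w‖ + δ ^ 2) := by linarith
    _ ≤ (A₁ + A₂) * ((B + 1) * δ ^ 2 + δ ^ 2) := by gcongr
    _ = _ := by ring

lemma sub_affProj_mem (zs : E) (K : Submodule ℝ E) (z : E) : z - affProj zs K z ∈ Kᗮ := by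
  have := Submodule.sub_starProjection_mem_orthogonal (K := K) (z - zs)
  rwa [sub_sub] at this

lemma affProj_sub_mem (zs : E) (K : Submodule ℝ E) (z : E) : affProj zs K z - zs ∈ K := by
  rw [affProj, add_sub_cancel_left]
  exact K.starProjection_apply_mem _

lemma norm_affProj_sub_le (zs : E) (K : Submodule ℝ E) (z y : E) :
    ‖affProj zs K z - affProj zs K y‖ ≤ ‖z - y‖ := by
  have : affProj zs K z - affProj zs K y = K.starProjection (z - y) := by
    rw [affProj, affProj, add_sub_add_left_eq_sub, ← map_sub, sub_sub_sub_cancel_right]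
  rw [this]
  exact K.norm_starProjection_apply_le _

lemma affProj_eq_self {zs : E} {K : Submodule ℝ E} {y : E} (hy : y - zs ∈ K) :
    affProj zs K y = y := by
  rw [affProj, Submodule.starProjection_eq_self_iff.mpr hy, add_sub_cancel]

/-- Pythagoras: `z - affProj zs K z` is orthogonal to `affProj zs K z - y ∈ K`. -/
lemma norm_sub_affProj_le {zs : E} {K : Submodule ℝ E} (z : E) {y : E} (hy : y - zs ∈ K) :
    ‖z - affProj zs K z‖ ≤ ‖z - y‖ := by
  have h1 : z - y = (z - affProj zs K z) + (affProj zs K z - y) := by abel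
  have h2 : affProj zs K z - y ∈ K := by
    simpa using K.sub_mem (affProj_sub_mem zs K z) hy
  have h3 := norm_add_sq_eq_norm_sq_add_norm_sq_of_inner_eq_zero _ _
    (Submodule.inner_left_of_mem_orthogonal h2 (sub_affProj_mem zs K z))
  rw [← h1] at h3
  nlinarith [norm_nonneg (z - y), norm_nonneg (z - affProj zs K z),
    mul_self_nonneg ‖affProj zs K z - y‖]

/-- Local estimates for a map that vanishes on `zs + K` and whose derivative at `zs` is injective
modulo `K`. -/
lemma exists_local_estimates {F : E → E} (hF : ContDiff ℝ 2 F) (zs : E) (K : Submodule ℝ E)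
    (hK : ∀ k ∈ K, F (zs + k) = 0) (hker : ∀ v, fderiv ℝ F zs v = 0 → v ∈ K) :
    ∃ ρ > 0, ∃ Λ > 0, ∃ σ > 0, ρ ≤ 1 ∧
      (∀ z ∈ ball zs ρ, ∀ w ∈ ball zs ρ, ‖F z - F w‖ ≤ Λ * ‖z - w‖) ∧
      ∀ z ∈ ball zs ρ,
        ‖F z - fderiv ℝ F z (z - affProj zs K z)‖ ≤ Λ * ‖z - affProj zs K z‖ ^ 2 ∧
        (∀ k ∈ K, ‖fderiv ℝ F z k‖ ≤ Λ * ‖z - affProj zs K z‖ * ‖k‖) ∧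
        (∀ v ∈ Kᗮ, σ * ‖v‖ ≤ ‖fderiv ℝ F z v‖) ∧
        σ / 2 * ‖z - affProj zs K z‖ ≤ ‖F z‖ := by
  have hd : Differentiable ℝ F := hF.differentiable (by norm_num)
  obtain ⟨L₁, t₁, ht₁, hL₁⟩ := ((hF.of_le (by norm_num)).contDiffAt (x := zs)).exists_lipschitzOnWith
    (𝕂 := ℝ)
  obtain ⟨L₂, t₂, ht₂, hL₂⟩ :=
    ((hF.fderiv_right (m := 1) (by norm_num)).contDiffAt (x := zs)).exists_lipschitzOnWith
  -- Since `K ∩ Kᗮ = 0`, the derivative at `zs` is injective on `Kᗮ`, hence bounded below there by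
  -- finite dimension.
  obtain ⟨κ, hκ, hanti⟩ := LinearMap.exists_antilipschitzWith
    ((fderiv ℝ F zs).toLinearMap.comp Kᗮ.subtype) (by
      rw [LinearMap.ker_eq_bot']
      intro v hv
      have h1 : (v : E) ∈ K := hker _ hv
      have h2 : inner ℝ (v : E) (v : E) = (0 : ℝ) := v.2 _ h1
      exact Subtype.ext (inner_self_eq_zero.mp h2))
  have hκ' : (0 : ℝ) < κ := hκ
  set σ : ℝ := 1 / (2 * κ) with hσ
  have hσ0 : 0 < σ := by positivity
  have hlow : ∀ v ∈ Kᗮ, 2 * σ * ‖v‖ ≤ ‖fderiv ℝ F zs v‖ := by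
    intro v hv
    have := hanti.le_mul_dist (⟨v, hv⟩ : Kᗮ) 0
    simp only [map_zero, dist_zero_right] at this
    have h' : ‖v‖ ≤ κ * ‖fderiv ℝ F zs v‖ := this
    have : 2 * σ = 1 / κ := by rw [hσ]; field_simp
    rw [this, one_div_mul_eq_div, div_le_iff₀ hκ']
    linarith
  obtain ⟨ρ₁, hρ₁, hb₁⟩ := Metric.mem_nhds_iff.mp ht₁
  obtain ⟨ρ₂, hρ₂, hb₂⟩ := Metric.mem_nhds_iff.mp ht₂
  set Λ : ℝ := L₁ + L₂ + 1 with hΛ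
  have hΛ0 : 0 < Λ := by positivity
  have hΛ1 : (L₁ : ℝ) ≤ Λ := by
    have : (0 : ℝ) ≤ L₂ := L₂.2
    linarith
  have hΛ2 : (L₂ : ℝ) ≤ Λ := by
    have : (0 : ℝ) ≤ L₁ := L₁.2
    linarith
  -- The last term gives `Λ * ρ ≤ σ / 2`. This keeps the lower bound `σ` on `Kᗮ` throughout the
  -- ball, and lets half of it absorb the Taylor remainder.
  set ρ : ℝ := min (min ρ₁ ρ₂) (min 1 (σ / (2 * Λ))) with hρ
  have hρ0 : 0 < ρ := by positivity
  have e1 : ρ ≤ ρ₁ := (min_le_left _ _).trans (min_le_left _ _)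
  have e2 : ρ ≤ ρ₂ := (min_le_left _ _).trans (min_le_right _ _)
  have e3 : ρ ≤ 1 := (min_le_right _ _).trans (min_le_left _ _)
  have e4 : Λ * ρ ≤ σ / 2 := by
    have : ρ ≤ σ / (2 * Λ) := (min_le_right _ _).trans (min_le_right _ _)
    rw [le_div_iff₀ (by positivity)] at this
    linarith
  have lip1 : ∀ z ∈ ball zs ρ, ∀ w ∈ ball zs ρ, ‖F z - F w‖ ≤ Λ * ‖z - w‖ := by
    intro z hz w hw
    exact (hL₁.norm_sub_le (hb₁ (ball_subset_ball e1 hz)) (hb₁ (ball_subset_ball e1 hw))).trans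
      (by gcongr)
  have lip2 : ∀ z ∈ ball zs ρ, ∀ w ∈ ball zs ρ,
      ‖fderiv ℝ F z - fderiv ℝ F w‖ ≤ Λ * ‖z - w‖ := by
    intro z hz w hw
    exact (hL₂.norm_sub_le (hb₂ (ball_subset_ball e2 hz)) (hb₂ (ball_subset_ball e2 hw))).trans
      (by gcongr)
  refine ⟨ρ, hρ0, Λ, hΛ0, σ, hσ0, e3, lip1, fun z hz => ?_⟩
  have hzs : zs ∈ ball zs ρ := mem_ball_self hρ0
  have hzn : ‖z - zs‖ < ρ := mem_ball_iff_norm.mp hz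
  have hzb : affProj zs K z ∈ ball zs ρ := by
    rw [mem_ball_iff_norm]
    have := norm_affProj_sub_le zs K z zs
    rw [affProj_eq_self (y := zs) (by simp)] at this
    exact this.trans_lt hzn
  have hFzb : F (affProj zs K z) = 0 := by
    have := hK _ (affProj_sub_mem zs K z)
    rwa [add_sub_cancel] at this
  have hδ : ‖z - affProj zs K z‖ ≤ ‖z - zs‖ := norm_sub_affProj_le z (by simp)
  have hT : ‖F z - fderiv ℝ F z (z - affProj zs K z)‖ ≤ Λ * ‖z - affProj zs K z‖ ^ 2 := by
    have := Convex.norm_image_sub_le_of_norm_fderiv_le' (f := F) (𝕜 := ℝ)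
      (s := segment ℝ z (affProj zs K z)) (φ := fderiv ℝ F z)
      (C := Λ * ‖z - affProj zs K z‖) (x := affProj zs K z) (y := z)
      (fun x _ => hd x) (fun x hx => by
        have hxb : x ∈ ball zs ρ := (convex_ball zs ρ).segment_subset hz hzb hx
        refine (lip2 x hxb z hz).trans ?_
        gcongr
        have := norm_sub_le_of_mem_segment hx
        rwa [norm_sub_rev (affProj zs K z) z] at this)
      (convex_segment _ _) (right_mem_segment _ _ _) (left_mem_segment _ _ _)
    rw [hFzb, sub_zero] at this
    linarith
  have hlow' : ∀ v ∈ Kᗮ, σ * ‖v‖ ≤ ‖fderiv ℝ F z v‖ := by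
    intro v hv
    have h1 := hlow v hv
    have h2 : ‖fderiv ℝ F zs v‖ ≤ ‖fderiv ℝ F z v‖ + ‖fderiv ℝ F zs - fderiv ℝ F z‖ * ‖v‖ := by
      have := (fderiv ℝ F zs - fderiv ℝ F z).le_opNorm v
      rw [sub_apply] at this
      linarith [norm_sub_norm_le (fderiv ℝ F zs v) (fderiv ℝ F z v)]
    have h3 : ‖fderiv ℝ F zs - fderiv ℝ F z‖ ≤ σ / 2 := by
      refine (lip2 zs hzs z hz).trans (le_trans ?_ e4)
      rw [norm_sub_rev]; gcongr
    have h4 : ‖fderiv ℝ F zs - fderiv ℝ F z‖ * ‖v‖ ≤ σ / 2 * ‖v‖ := by gcongr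
    have h5 : 0 ≤ σ / 2 * ‖v‖ := by positivity
    linarith
  refine ⟨hT, ?_, hlow', ?_⟩
  · intro k hk
    -- `F` vanishes along the whole line through the projection in direction `k`.
    have hzero : fderiv ℝ F (affProj zs K z) k = 0 := by
      have h1 : HasDerivAt (fun t : ℝ => affProj zs K z + t • k) k 0 := by
        simpa using ((hasDerivAt_id (0 : ℝ)).smul_const k).const_add (affProj zs K z)
      have h2 : HasFDerivAt F (fderiv ℝ F (affProj zs K z)) (affProj zs K z + (0 : ℝ) • k) := by
        simpa using (hd (affProj zs K z)).hasFDerivAt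
      have h3 := h2.comp_hasDerivAt (0 : ℝ) h1
      have h4 : (F ∘ fun t : ℝ => affProj zs K z + t • k) = fun _ => 0 := by
        funext t
        have := hK _ (K.add_mem (affProj_sub_mem zs K z) (K.smul_mem t hk))
        rw [← add_assoc, add_sub_cancel] at this
        exact this
      rw [h4] at h3
      exact h3.unique (hasDerivAt_const _ _)
    have := (fderiv ℝ F z - fderiv ℝ F (affProj zs K z)).le_opNorm k
    rw [sub_apply, hzero, sub_zero] at this
    exact this.trans (by gcongr; exact lip2 z hz _ hzb)
  · have h1 := hlow' _ (sub_affProj_mem zs K z)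
    have h2 : ‖fderiv ℝ F z (z - affProj zs K z)‖
        ≤ ‖F z‖ + ‖F z - fderiv ℝ F z (z - affProj zs K z)‖ := by
      rw [norm_sub_rev]
      linarith [norm_sub_norm_le (fderiv ℝ F z (z - affProj zs K z)) (F z)]
    have h3 : Λ * ‖z - affProj zs K z‖ ^ 2 ≤ σ / 2 * ‖z - affProj zs K z‖ := by
      rw [pow_two, ← mul_assoc]
      gcongr
      refine le_trans ?_ e4
      gcongr
      linarith
    linarith

/-- A Levenberg-Marquardt step near `zs` lands within second order of the projection of the
starting point. -/
lemma exists_norm_step_sub_affProj_le {F : E → E} (hF : ContDiff ℝ 2 F) (zs : E)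
    (K : Submodule ℝ E) (hK : ∀ k ∈ K, F (zs + k) = 0)
    (hker : ∀ v, fderiv ℝ F zs v = 0 → v ∈ K) :
    ∃ ρ > 0, ∃ C > 0, ∃ M > 0,
      (∀ z ∈ ball zs ρ, ∀ z', IsLMStep F z z' →
        ‖z' - affProj zs K z‖ ≤ C * ‖z - affProj zs K z‖ ^ 2) ∧
      ∀ z ∈ ball zs ρ, ‖z - affProj zs K z‖ ≤ M * infDist z {w | F w = 0} := by
  obtain ⟨ρ, hρ, Λ, hΛ, σ, hσ, hρ1, hlip, hest⟩ := exists_local_estimates hF zs K hK hker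
  obtain ⟨C, hC, hstep⟩ := exists_norm_le_of_normal_eq K hΛ hσ (half_pos hσ)
  -- Halving the radius keeps a nearest zero of `F` inside the ball of radius `ρ`, where the
  -- Lipschitz bound applies.
  refine ⟨ρ / 2, by positivity, C, hC, Λ / (σ / 2), by positivity, ?_, ?_⟩
  · intro z hz z' hz'
    have hzρ : z ∈ ball zs ρ := ball_subset_ball (by linarith) hz
    obtain ⟨h1, h2, h3, h4⟩ := hest z hzρ
    have hzn : ‖z - zs‖ < ρ := mem_ball_iff_norm.mp hzρ
    have hδ : ‖z - affProj zs K z‖ ≤ ‖z - zs‖ := norm_sub_affProj_le z (by simp)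
    have hFzb : F (affProj zs K z) = 0 := by
      have := hK _ (affProj_sub_mem zs K z)
      rwa [add_sub_cancel] at this
    rcases (norm_nonneg (z - affProj zs K z)).eq_or_lt with h0 | hpos
    · have hzz : z = affProj zs K z := sub_eq_zero.mp (norm_eq_zero.mp h0.symm)
      rw [← hzz] at hFzb
      rw [hz'.1 hFzb, ← h0]
      simp
    · refine hstep (fderiv ℝ F z) _ (z - affProj zs K z)
        (F z - fderiv ℝ F z (z - affProj zs K z)) _ ‖F z‖ hpos (by linarith)
        (sub_affProj_mem zs K z) le_rfl h1 h2 h3 h4 ?_ ?_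
      · have hzb : affProj zs K z ∈ ball zs ρ := by
          rw [mem_ball_iff_norm]
          have := norm_affProj_sub_le zs K z zs
          rw [affProj_eq_self (y := zs) (by simp)] at this
          exact this.trans_lt hzn
        have := hlip z hzρ _ hzb
        rwa [hFzb, sub_zero] at this
      -- Adding `TᵀT u + ν u`, with `u = z - affProj zs K z`, recentres the step at the projection
      -- and leaves the Taylor remainder as `q`.
      · have e : z' - affProj zs K z = (z' - z) + (z - affProj zs K z) := by abel
        have := hz'.2
        rw [e, map_add, map_add, smul_add, add_add_add_comm, this,
          map_sub (ContinuousLinearMap.adjoint _) (F z)]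
        abel
  · intro z hz
    have hzn : ‖z - zs‖ < ρ / 2 := mem_ball_iff_norm.mp hz
    have hzρ : z ∈ ball zs ρ := ball_subset_ball (by linarith) hz
    have hF0 : F zs = 0 := by simpa using hK 0 K.zero_mem
    have hclosed : IsClosed {w | F w = 0} := isClosed_eq hF.continuous continuous_const
    have : ProperSpace E := FiniteDimensional.proper_real E
    obtain ⟨y, hy, hyd⟩ := hclosed.exists_infDist_eq_dist ⟨zs, hF0⟩ z
    have hyz : dist z y ≤ dist z zs := hyd ▸ infDist_le_dist_of_mem hF0
    have hyρ : y ∈ ball zs ρ := by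
      rw [mem_ball]
      have h1 : dist z zs < ρ / 2 := hz
      have := dist_triangle_left y zs z
      linarith
    have h1 := hlip z hzρ y hyρ
    rw [show F y = 0 from hy, sub_zero] at h1
    have h2 := (hest z hzρ).2.2.2
    rw [hyd, dist_eq_norm, div_mul_eq_mul_div, le_div_iff₀ (by positivity)]
    linarith

/-- Existence and uniqueness of the Levenberg-Marquardt step. -/
lemma existsUnique_isLMStep (F : E → E) (z : E) : ∃! z', IsLMStep F z z' := by
  by_cases h : F z = 0
  · exact ⟨z, by simp [IsLMStep, h], fun y hy => hy.1 h⟩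
  have hν : 0 < ‖F z‖ := norm_pos_iff.mpr h
  set T := fderiv ℝ F z
  set G : E →ₗ[ℝ] E :=
    (ContinuousLinearMap.adjoint T ∘L T + ‖F z‖ • ContinuousLinearMap.id ℝ E).toLinearMap with hG
  have hGapp : ∀ v, G v = ContinuousLinearMap.adjoint T (T v) + ‖F z‖ • v := fun v => rfl
  have hinj : Function.Injective G := by
    rw [injective_iff_map_eq_zero]
    intro v hv
    -- The quadratic form of `G` is `‖T v‖² + ‖F z‖ ‖v‖²`, positive definite because `F z ≠ 0`.
    have h1 : inner ℝ (G v) v = (0 : ℝ) := by rw [hv, inner_zero_left]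
    rw [hGapp, inner_add_left, ContinuousLinearMap.adjoint_inner_left, inner_smul_left,
      real_inner_self_eq_norm_sq, real_inner_self_eq_norm_sq] at h1
    have h2 : ‖F z‖ * ‖v‖ ^ 2 = 0 := by
      have : 0 ≤ ‖F z‖ * ‖v‖ ^ 2 := by positivity
      simp only [conj_trivial] at h1
      nlinarith [sq_nonneg ‖T v‖]
    simpa [hν.ne'] using h2
  obtain ⟨v, hv⟩ := (LinearMap.injective_iff_surjective.mp hinj)
    (-ContinuousLinearMap.adjoint T (F z))
  refine ⟨z + v, ⟨fun h0 => absurd h0 h, ?_⟩, ?_⟩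
  · rw [add_sub_cancel_left]; exact hv
  · intro y hy
    have : G (y - z) = G v := hy.2.trans hv.symm
    rw [← hinj this, add_sub_cancel]

/-- Local quadratic convergence of the Levenberg-Marquardt method when the solution set contains
`zs + K` and the kernel of the derivative at `zs` is contained in `K`. -/
theorem exists_quadratic_convergence {F : E → E} (hF : ContDiff ℝ 2 F) (zs : E)
    (K : Submodule ℝ E) (hK : ∀ k ∈ K, F (zs + k) = 0)
    (hker : ∀ v, fderiv ℝ F zs v = 0 → v ∈ K) :
    ∃ r > 0, ∃ C > 0, ∀ z : ℕ → E, ‖z 0 - zs‖ < r → (∀ k, IsLMStep F (z k) (z (k + 1))) →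
      ∃ zh, F zh = 0 ∧ Tendsto z atTop (𝓝 zh) ∧
        (∀ k, ‖z (k + 1) - zh‖ ≤ C * ‖z k - zh‖ ^ 2) ∧
        ∀ k, infDist (z (k + 1)) {w | F w = 0} ≤ C * infDist (z k) {w | F w = 0} ^ 2 := by
  obtain ⟨ρ, hρ, C₀, hC₀, M, hM, hstep, hdist⟩ :=
    exists_norm_step_sub_affProj_le hF zs K hK hker
  -- Chosen so that `2 * r` stays within the radius `ρ` and `C₀ * δ ≤ 1 / 2` whenever `δ < 2 * r`,
  -- so each step at least halves `δ`.
  set r := min (ρ / 2) (1 / (4 * C₀)) with hr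
  have hr0 : 0 < r := by positivity
  refine ⟨r, hr0, 3 * C₀ + C₀ * M ^ 2, by positivity, fun z hz0 hz => ?_⟩
  set p : ℕ → E := fun k => affProj zs K (z k) with hp
  set δ : ℕ → ℝ := fun k => ‖z k - p k‖ with hδ
  have hδ0 : ∀ k, 0 ≤ δ k := fun k => norm_nonneg _
  have hpK : ∀ k, p k - zs ∈ K := fun k => affProj_sub_mem _ _ _
  have hFaff : ∀ y, y - zs ∈ K → F y = 0 := fun y hy => by
    have := hK _ hy
    rwa [add_sub_cancel] at this
  have hr1 : 2 * r ≤ ρ := by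
    have := min_le_left (ρ / 2) (1 / (4 * C₀)); linarith
  have hr2 : C₀ * (2 * r) ≤ 1 / 2 := by
    have : r ≤ 1 / (4 * C₀) := min_le_right _ _
    rw [le_div_iff₀ (by positivity)] at this
    linarith
  have hstep' : ∀ k, ‖p k - zs‖ + δ k < 2 * r →
      ‖z (k + 1) - p k‖ ≤ C₀ * δ k ^ 2 ∧ δ (k + 1) ≤ C₀ * δ k ^ 2 ∧
      ‖p (k + 1) - p k‖ ≤ C₀ * δ k ^ 2 ∧ C₀ * δ k ^ 2 ≤ δ k / 2 ∧ z k ∈ ball zs ρ := by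
    intro k hk
    have hzk : z k ∈ ball zs ρ := by
      rw [mem_ball_iff_norm]
      have : ‖z k - zs‖ ≤ ‖z k - p k‖ + ‖p k - zs‖ := norm_sub_le_norm_sub_add_norm_sub _ _ _
      have h' : ‖z k - p k‖ = δ k := rfl
      linarith
    have h1 := hstep _ hzk _ (hz k)
    refine ⟨h1, (norm_sub_affProj_le _ (hpK k)).trans h1, ?_, ?_, hzk⟩
    · have := norm_affProj_sub_le zs K (z (k + 1)) (p k)
      rw [affProj_eq_self (hpK k)] at this
      exact this.trans h1
    · have h2 : C₀ * δ k ≤ 1 / 2 := le_trans (by gcongr; linarith [norm_nonneg (p k - zs)]) hr2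
      nlinarith [hδ0 k]
  -- The sum never grows: `p` moves by at most `δ k / 2`, and `δ` drops by at least as much.
  -- Initially each term is at most `‖z 0 - zs‖`, whence the factor 2.
  have hinv : ∀ k, ‖p k - zs‖ + δ k < 2 * r := by
    intro k
    induction k with
    | zero =>
      have h1 : δ 0 ≤ ‖z 0 - zs‖ := norm_sub_affProj_le _ (by simp)
      have h2 := norm_affProj_sub_le zs K (z 0) zs
      rw [affProj_eq_self (y := zs) (by simp)] at h2
      have h3 : ‖p 0 - zs‖ ≤ ‖z 0 - zs‖ := h2
      linarith
    | succ k ih =>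
      obtain ⟨-, h2, h3, h4, -⟩ := hstep' k ih
      have := norm_sub_le_norm_sub_add_norm_sub (p (k + 1)) (p k) zs
      linarith
  have hgeo : ∀ k j, δ (k + j) ^ 2 ≤ δ k ^ 2 * (1 / 2) ^ j := by
    intro k j
    induction j with
    | zero => simp
    | succ j ih =>
      obtain ⟨-, h2, -, h4, -⟩ := hstep' (k + j) (hinv _)
      have h5 : δ (k + (j + 1)) ≤ δ (k + j) / 2 := h2.trans h4
      have h6 : δ (k + (j + 1)) ^ 2 ≤ (δ (k + j) / 2) ^ 2 := by
        gcongr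
      rw [pow_succ (1 / 2 : ℝ) j]
      nlinarith [sq_nonneg (δ (k + j))]
  have hpgeo : ∀ k j, dist (p (k + j)) (p (k + (j + 1))) ≤ C₀ * δ k ^ 2 * (1 / 2) ^ j := by
    intro k j
    rw [dist_comm, dist_eq_norm]
    refine (hstep' (k + j) (hinv _)).2.2.1.trans ?_
    rw [mul_assoc]
    exact mul_le_mul_of_nonneg_left (hgeo k j) hC₀.le
  have : CompleteSpace E := FiniteDimensional.complete ℝ E
  have hcau : CauchySeq p := cauchySeq_of_le_geometric (1 / 2) (C₀ * δ 0 ^ 2) (by norm_num)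
    (fun j => by simpa using hpgeo 0 j)
  obtain ⟨zh, hzh⟩ := cauchySeq_tendsto_of_complete hcau
  have hpz : ∀ k, ‖p k - zh‖ ≤ 2 * (C₀ * δ k ^ 2) := by
    intro k
    have h1 : Tendsto (fun j => p (k + j)) atTop (𝓝 zh) := by
      simp_rw [add_comm k]
      exact (tendsto_add_atTop_iff_nat k).mpr hzh
    have := dist_le_of_le_geometric_of_tendsto (1 / 2) (C₀ * δ k ^ 2) (by norm_num) (hpgeo k) h1 0
    rw [dist_eq_norm] at this
    norm_num at this
    linarith
  -- The limit stays in the closed affine space `zs + K`, so it is a zero of `F` and `δ k ≤ ‖z k -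
  -- zh‖`.
  have hzhK : zh - zs ∈ K :=
    K.closed_of_finiteDimensional.mem_of_tendsto (hzh.sub_const zs) (Eventually.of_forall hpK)
  have hzq : ∀ k, ‖z (k + 1) - zh‖ ≤ 3 * C₀ * δ k ^ 2 := by
    intro k
    have h1 := (hstep' k (hinv k)).1
    have h2 := hpz k
    have := norm_sub_le_norm_sub_add_norm_sub (z (k + 1)) (p k) zh
    linarith
  refine ⟨zh, hFaff _ hzhK, ?_, ?_, ?_⟩
  · rw [← tendsto_add_atTop_iff_nat 1, tendsto_iff_norm_sub_tendsto_zero]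
    have h1 : Tendsto (fun k : ℕ => 3 * C₀ * (δ 0 ^ 2 * (1 / 2 : ℝ) ^ k)) atTop (𝓝 0) := by
      have := (tendsto_pow_atTop_nhds_zero_of_lt_one (r := (1 / 2 : ℝ)) (by norm_num)
        (by norm_num)).const_mul (3 * C₀ * δ 0 ^ 2)
      simpa [mul_assoc] using this
    refine squeeze_zero (fun _ => norm_nonneg _) (fun k => (hzq k).trans ?_) h1
    have := hgeo 0 k
    rw [zero_add] at this
    exact mul_le_mul_of_nonneg_left this (by positivity)
  · intro k
    have h1 : δ k ≤ ‖z k - zh‖ := norm_sub_affProj_le _ hzhK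
    calc _ ≤ 3 * C₀ * δ k ^ 2 := hzq k
      _ ≤ 3 * C₀ * ‖z k - zh‖ ^ 2 := by gcongr
      _ ≤ _ := by gcongr; linarith [show 0 ≤ C₀ * M ^ 2 by positivity]
  · intro k
    obtain ⟨-, h2, -, -, h5⟩ := hstep' k (hinv k)
    have h3 : δ k ≤ M * infDist (z k) {w | F w = 0} := hdist _ h5
    have h6 : infDist (z (k + 1)) {w | F w = 0} ≤ δ (k + 1) := by
      have := infDist_le_dist_of_mem (x := z (k + 1)) (s := {w | F w = 0})
        (hFaff _ (hpK (k + 1)))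
      rwa [dist_eq_norm] at this
    calc _ ≤ C₀ * δ k ^ 2 := h6.trans h2
      _ ≤ C₀ * (M * infDist (z k) {w | F w = 0}) ^ 2 := by gcongr
      _ = C₀ * M ^ 2 * infDist (z k) {w | F w = 0} ^ 2 := by ring
      _ ≤ _ := by gcongr; linarith

end LevenbergMarquardt

/-! ### Smoothness of polynomial-valued maps, and calculus of derivatives. -/

section Smoothness

variable {V : Type*} [NormedAddCommGroup V] [NormedSpace ℝ V] {n : WithTop ℕ∞}

/-- All coefficients of the polynomial-valued map `f` are `n` times continuously differentiable. -/
def CoeffContDiff (n : WithTop ℕ∞) (f : V → ℝ[X]) : Prop :=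
  ∀ k, ContDiff ℝ n fun x => (f x).coeff k

lemma CoeffContDiff.const (p : ℝ[X]) : CoeffContDiff n fun _ : V => p :=
  fun _ => contDiff_const

lemma CoeffContDiff.add {f g : V → ℝ[X]} (hf : CoeffContDiff n f) (hg : CoeffContDiff n g) :
    CoeffContDiff n fun x => f x + g x := fun k => by
  simpa only [coeff_add] using (hf k).add (hg k)

lemma CoeffContDiff.sub {f g : V → ℝ[X]} (hf : CoeffContDiff n f) (hg : CoeffContDiff n g) :
    CoeffContDiff n fun x => f x - g x := fun k => by
  simpa only [coeff_sub] using (hf k).sub (hg k)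

lemma CoeffContDiff.mul {f g : V → ℝ[X]} (hf : CoeffContDiff n f) (hg : CoeffContDiff n g) :
    CoeffContDiff n fun x => f x * g x := fun k => by
  simp only [coeff_mul]
  exact ContDiff.sum fun i _ => (hf _).mul (hg _)

lemma CoeffContDiff.smul {a : V → ℝ} (ha : ContDiff ℝ n a) (p : ℝ[X]) :
    CoeffContDiff n fun x => a x • p := fun k => by
  simpa only [coeff_smul, smul_eq_mul] using ha.mul contDiff_const

lemma CoeffContDiff.sum {ι : Type*} {s : Finset ι} {f : ι → V → ℝ[X]}
    (hf : ∀ i ∈ s, CoeffContDiff n (f i)) : CoeffContDiff n fun x => ∑ i ∈ s, f i x := fun k => by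
  simp only [finsetSum_coeff]
  exact ContDiff.sum fun i hi => hf i hi k

lemma CoeffContDiff.prod {ι : Type*} {s : Finset ι} {f : ι → V → ℝ[X]}
    (hf : ∀ i ∈ s, CoeffContDiff n (f i)) : CoeffContDiff n fun x => ∏ i ∈ s, f i x := by
  classical
  induction s using Finset.induction_on with
  | empty => simpa using CoeffContDiff.const 1
  | insert i s hi ih =>
    simp only [Finset.prod_insert hi]
    exact (hf i (Finset.mem_insert_self i s)).mul
      (ih fun j hj => hf j (Finset.mem_insert_of_mem hj))

lemma CoeffContDiff.det {ι : Type*} [Fintype ι] [DecidableEq ι] {M : V → Matrix ι ι ℝ[X]}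
    (hM : ∀ i j, CoeffContDiff n fun x => M x i j) : CoeffContDiff n fun x => (M x).det := by
  simp only [Matrix.det_apply']
  exact .sum fun σ _ => (CoeffContDiff.const _).mul (.prod fun i _ => hM _ _)

lemma CoeffContDiff.adjugate {ι : Type*} [Fintype ι] [DecidableEq ι] {M : V → Matrix ι ι ℝ[X]}
    (hM : ∀ i j, CoeffContDiff n fun x => M x i j) (i j : ι) :
    CoeffContDiff n fun x => (M x).adjugate i j := by
  simp only [Matrix.adjugate_apply]
  refine .det fun k l => ?_
  by_cases h : k = j
  · subst h
    simpa only [Matrix.updateRow_self] using CoeffContDiff.const _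
  · simpa only [Matrix.updateRow_ne h] using hM k l

lemma CoeffContDiff.affineCombo {k : ℕ} (v₀ : ℝ[X]) (v : Fin k → ℝ[X]) {p : V → Fin k → ℝ}
    (hp : ∀ i, ContDiff ℝ n fun x => p x i) :
    CoeffContDiff n fun x => affineCombo v₀ v (p x) :=
  (CoeffContDiff.const v₀).add (.sum fun i _ => .smul (hp i) (v i))

lemma affineCombo_apply {k : ℕ} {ι : Type*} (v₀ : Matrix ι ι ℝ[X]) (v : Fin k → Matrix ι ι ℝ[X])
    (p : Fin k → ℝ) (i j : ι) :
    affineCombo v₀ v p i j = affineCombo (v₀ i j) (fun s => v s i j) p := by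
  simp [affineCombo, Matrix.sum_apply]

lemma contDiff_gradient {E : Type*} [NormedAddCommGroup E] [InnerProductSpace ℝ E]
    [FiniteDimensional ℝ E] {f : E → ℝ} {m : WithTop ℕ∞} (hf : ContDiff ℝ n f) (hmn : m + 1 ≤ n) :
    ContDiff ℝ m (gradient f) := by
  set D : StrongDual ℝ E →ₗ[ℝ] E :=
    { toFun := (InnerProductSpace.toDual ℝ E).symm
      map_add' := map_add _
      map_smul' := fun a y => by simp } with hD
  exact D.toContinuousLinearMap.contDiff.comp (hf.fderiv_right hmn)

lemma fderiv_apply_of_comp_eq {A B C D : Type*} [NormedAddCommGroup A] [NormedSpace ℝ A]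
    [NormedAddCommGroup B] [NormedSpace ℝ B] [NormedAddCommGroup C] [NormedSpace ℝ C]
    [NormedAddCommGroup D] [NormedSpace ℝ D] {F : A → B} {c : D → C} (g : B →L[ℝ] C)
    (e : A →L[ℝ] D) {z : A} (hF : DifferentiableAt ℝ F z) (hc : DifferentiableAt ℝ c (e z))
    (h : ∀ w, g (F w) = c (e w)) (v : A) : g (fderiv ℝ F z v) = fderiv ℝ c (e z) (e v) := by
  have h1 := g.hasFDerivAt.comp z hF.hasFDerivAt
  have h2 := hc.hasFDerivAt.comp z e.hasFDerivAt
  rw [show g ∘ F = c ∘ e from funext h] at h1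
  exact DFunLike.congr_fun (h1.unique h2) v

/-- Only the increments of `F` along the range of `i` need be linear. This yields the multiplier
columns of the Hessian. -/
lemma fderiv_apply_of_add_eq {A B C : Type*} [NormedAddCommGroup A] [NormedSpace ℝ A]
    [NormedAddCommGroup B] [NormedSpace ℝ B] [NormedAddCommGroup C] [NormedSpace ℝ C]
    {F : A → B} (i : C →L[ℝ] A) (j : C →L[ℝ] B) {z : A} (hF : DifferentiableAt ℝ F z)
    (h : ∀ l, F (z + i l) = F z + j l) (l : C) : fderiv ℝ F z (i l) = j l := by
  have h1 : HasFDerivAt F (fderiv ℝ F z) (z + i 0) := by simpa using hF.hasFDerivAt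
  have h2 := h1.comp (0 : C) (i.hasFDerivAt.const_add z)
  rw [show (F ∘ fun l => z + i l) = fun l => F z + j l from funext h] at h2
  exact DFunLike.congr_fun (h2.unique (j.hasFDerivAt.const_add _)) l

end Smoothness

/-! ### Block structure of the gradient and Hessian of the Lagrangian. -/

namespace Problem

variable (P : Problem) {n : WithTop ℕ∞}

lemma contDiff_coord (s : P.VarIdx) : ContDiff ℝ n fun x : P.Var => x s :=
  (EuclideanSpace.proj (𝕜 := ℝ) s).contDiff

lemma coeffContDiff_deltaA (i j : Fin P.n) : CoeffContDiff n fun x => P.deltaA x i j := by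
  simp only [deltaA, affineCombo_apply]
  exact .affineCombo _ _ fun _ => P.contDiff_coord _

lemma coeffContDiff_cofactor (i j : Fin P.n) : CoeffContDiff n fun x => P.cofactor x i j := by
  simp only [cofactor, affineCombo_apply]
  exact .affineCombo _ _ fun _ => P.contDiff_coord _

lemma coeffContDiff_divisor : CoeffContDiff n P.divisor :=
  .affineCombo _ _ fun _ => P.contDiff_coord _

lemma contDiff_objective : ContDiff ℝ n P.objective :=
  ContDiff.sum fun i _ => ContDiff.sum fun j _ => ContDiff.sum fun k _ =>
    (P.coeffContDiff_deltaA i j k).pow 2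

lemma contDiff_constraint : ContDiff ℝ n P.constraint := by
  rw [contDiff_euclidean]
  rintro (⟨i, j, k⟩ | _)
  · exact ((CoeffContDiff.adjugate (fun i j => (CoeffContDiff.const (P.A i j)).add
      (P.coeffContDiff_deltaA i j)) i j).sub
      ((P.coeffContDiff_cofactor i j).mul P.coeffContDiff_divisor)) k
  · have h : ContDiff ℝ n fun x => (∑ k, P.normRow k * (P.divisor x).coeff k) - 1 :=
      (ContDiff.sum fun (k : Fin (P.m + 1)) _ =>
        (contDiff_const (c := P.normRow k)).mul (P.coeffContDiff_divisor (k : ℕ))).sub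
          contDiff_const
    exact h

/-- The Lagrangian as a function of `z = (x, λ)`. -/
def lagr (z : P.Pt) : ℝ := P.lagrangian z.fst z.snd

/-- The embedding `x ↦ (x, 0)`. -/
def inlL : P.Var →L[ℝ] P.Pt :=
  (WithLp.prodContinuousLinearEquiv 2 ℝ P.Var P.Mult).symm.toContinuousLinearMap ∘L
    ContinuousLinearMap.inl ℝ P.Var P.Mult

/-- The embedding `λ ↦ (0, λ)`. -/
def inrL : P.Mult →L[ℝ] P.Pt :=
  (WithLp.prodContinuousLinearEquiv 2 ℝ P.Var P.Mult).symm.toContinuousLinearMap ∘L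
    ContinuousLinearMap.inr ℝ P.Var P.Mult

@[simp] lemma inlL_fst (x : P.Var) : (P.inlL x).fst = x := rfl
@[simp] lemma inlL_snd (x : P.Var) : (P.inlL x).snd = 0 := rfl
@[simp] lemma inrL_fst (l : P.Mult) : (P.inrL l).fst = 0 := rfl
@[simp] lemma inrL_snd (l : P.Mult) : (P.inrL l).snd = l := rfl

lemma pt_ext {z w : P.Pt} (h1 : z.fst = w.fst) (h2 : z.snd = w.snd) : z = w :=
  WithLp.ofLp_injective 2 (Prod.ext h1 h2)

lemma inlL_add_inrL (z : P.Pt) : P.inlL z.fst + P.inrL z.snd = z :=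
  P.pt_ext (by simp) (by simp)

lemma contDiff_fst : ContDiff ℝ n fun z : P.Pt => z.fst :=
  (WithLp.fstL 2 ℝ P.Var P.Mult).contDiff

lemma contDiff_snd : ContDiff ℝ n fun z : P.Pt => z.snd :=
  (WithLp.sndL 2 ℝ P.Var P.Mult).contDiff

lemma contDiff_lagr : ContDiff ℝ n P.lagr :=
  (P.contDiff_objective.comp P.contDiff_fst).add
    (P.contDiff_snd.inner ℝ (P.contDiff_constraint.comp P.contDiff_fst))

lemma contDiff_gradL : ContDiff ℝ n P.gradL :=
  contDiff_gradient (n := n + 1) P.contDiff_lagr le_rfl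

lemma hasFDerivAt_inlL_add (l : P.Mult) (x : P.Var) :
    HasFDerivAt (fun x => P.inlL x + P.inrL l) P.inlL x :=
  P.inlL.hasFDerivAt.add_const _

lemma hasFDerivAt_inrL_add (x : P.Var) (l : P.Mult) :
    HasFDerivAt (fun l => P.inlL x + P.inrL l) P.inrL l :=
  P.inrL.hasFDerivAt.const_add _

lemma differentiable_lagr : Differentiable ℝ P.lagr :=
  P.contDiff_lagr.differentiable one_ne_zero

lemma differentiable_gradL : Differentiable ℝ P.gradL :=
  P.contDiff_gradL.differentiable one_ne_zero

lemma differentiable_constraint : Differentiable ℝ P.constraint :=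
  P.contDiff_constraint.differentiable one_ne_zero

lemma inner_gradL (z w : P.Pt) : inner ℝ (P.gradL z) w = fderiv ℝ P.lagr z w :=
  inner_gradient_left

lemma gradL_snd (z : P.Pt) : (P.gradL z).snd = P.constraint z.fst := by
  refine ext_inner_right ℝ fun l => ?_
  have h1 : inner ℝ (P.gradL z).snd l = inner ℝ (P.gradL z) (P.inrL l) := by
    rw [WithLp.prod_inner_apply]
    simp
  have h2 : HasFDerivAt P.lagr (fderiv ℝ P.lagr z) (P.inlL z.fst + P.inrL z.snd) := by
    rw [P.inlL_add_inrL]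
    exact (P.differentiable_lagr z).hasFDerivAt
  have h3 := h2.comp z.snd (P.hasFDerivAt_inrL_add z.fst z.snd)
  have h4 : HasFDerivAt (fun l : P.Mult => P.objective z.fst + inner ℝ (P.constraint z.fst) l)
      (innerSL ℝ (P.constraint z.fst)) z.snd :=
    (innerSL ℝ (P.constraint z.fst)).hasFDerivAt.const_add _
  have h5 : (P.lagr ∘ fun l => P.inlL z.fst + P.inrL l)
      = fun l : P.Mult => P.objective z.fst + inner ℝ (P.constraint z.fst) l := by
    funext l
    simp [lagr, lagrangian, real_inner_comm]
  rw [h5] at h3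
  have := congrArg (fun T => T l) (h3.unique h4)
  rw [h1, inner_gradL]
  exact this

lemma gradL_fst (z : P.Pt) :
    (P.gradL z).fst = gradient (fun x : P.Var => P.lagrangian x z.snd) z.fst := by
  refine ext_inner_right ℝ fun y => ?_
  have h1 : inner ℝ (P.gradL z).fst y = inner ℝ (P.gradL z) (P.inlL y) := by
    rw [WithLp.prod_inner_apply]
    simp
  have h2 : HasFDerivAt P.lagr (fderiv ℝ P.lagr z) (P.inlL z.fst + P.inrL z.snd) := by
    rw [P.inlL_add_inrL]
    exact (P.differentiable_lagr z).hasFDerivAt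
  have h3 := h2.comp z.fst (P.hasFDerivAt_inlL_add z.snd z.fst)
  have h5 : (P.lagr ∘ fun x => P.inlL x + P.inrL z.snd)
      = fun x : P.Var => P.lagrangian x z.snd := by
    funext x
    simp [lagr]
  rw [h5] at h3
  rw [h1, inner_gradL, inner_gradient_left, h3.fderiv]
  rfl

/-- The Lagrangian is affine in the multiplier, so the formula is exact for every `l`, not merely to
first order. -/
lemma gradL_add_inrL (z : P.Pt) (l : P.Mult) :
    P.gradL (z + P.inrL l)
      = P.gradL z + P.inlL (ContinuousLinearMap.adjoint (P.jac z) l) := by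
  refine P.pt_ext ?_ ?_
  · refine ext_inner_right ℝ fun y => ?_
    have h1 : DifferentiableAt ℝ (fun x : P.Var => P.lagrangian x z.snd) z.fst :=
      ((P.contDiff_objective (n := 1)).add (contDiff_const.inner ℝ
        P.contDiff_constraint)).differentiable one_ne_zero _
    have h2 : HasFDerivAt (fun x : P.Var => inner ℝ l (P.constraint x))
        (innerSL ℝ l ∘L P.jac z) z.fst :=
      (innerSL ℝ l).hasFDerivAt.comp z.fst (P.differentiable_constraint z.fst).hasFDerivAt
    have h3 := h1.hasFDerivAt.add h2
    have h4 : (fun x : P.Var => P.lagrangian x (z + P.inrL l).snd)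
        = (fun x : P.Var => P.lagrangian x z.snd) + fun x => inner ℝ l (P.constraint x) := by
      funext x
      simp [lagrangian, inner_add_left, add_assoc]
    rw [gradL_fst, WithLp.add_fst, WithLp.add_fst, inlL_fst, gradL_fst, inner_gradient_left, h4,
      inrL_fst, add_zero, h3.fderiv, inner_add_left, inner_gradient_left,
      ContinuousLinearMap.adjoint_inner_left]
    rfl
  · rw [WithLp.add_snd, gradL_snd, gradL_snd]
    simp

lemma hessL_snd (z v : P.Pt) : (P.hessL z v).snd = P.jac z v.fst :=
  fderiv_apply_of_comp_eq (WithLp.sndL 2 ℝ P.Var P.Mult) (WithLp.fstL 2 ℝ P.Var P.Mult)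
    (P.differentiable_gradL z) (P.differentiable_constraint z.fst) P.gradL_snd v

lemma hessL_inlL_fst (z : P.Pt) (y : P.Var) : (P.hessL z (P.inlL y)).fst = P.hessXX z y := by
  have h1 : HasFDerivAt P.gradL (P.hessL z) (P.inlL z.fst + P.inrL z.snd) := by
    rw [P.inlL_add_inrL]
    exact (P.differentiable_gradL z).hasFDerivAt
  have h2 := (WithLp.fstL 2 ℝ P.Var P.Mult).hasFDerivAt.comp z.fst
    (h1.comp z.fst (P.hasFDerivAt_inlL_add z.snd z.fst))
  have h3 : (WithLp.fstL 2 ℝ P.Var P.Mult) ∘ P.gradL ∘ (fun x => P.inlL x + P.inrL z.snd)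
      = gradient fun x : P.Var => P.lagrangian x z.snd := by
    funext x
    have := P.gradL_fst (P.inlL x + P.inrL z.snd)
    simpa using this
  rw [h3] at h2
  rw [hessXX, h2.fderiv]
  rfl

lemma hessL_inrL (z : P.Pt) (l : P.Mult) :
    P.hessL z (P.inrL l) = P.inlL (ContinuousLinearMap.adjoint (P.jac z) l) :=
  fderiv_apply_of_add_eq P.inrL (P.inlL ∘L ContinuousLinearMap.adjoint (P.jac z))
    (P.differentiable_gradL z) (P.gradL_add_inrL z) l

/-! ### Degenerate directions of the Hessian, and the iteration itself. -/

/-- The directions `(0, μ)` with `Jᵀ μ = 0`, along which the multiplier is not determined. -/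
def multKer (z : P.Pt) : Submodule ℝ P.Pt :=
  (ContinuousLinearMap.adjoint (P.jac z)).toLinearMap.ker.map P.inrL.toLinearMap

lemma gradL_add_of_mem_multKer {z k : P.Pt} (hz : P.FirstOrder z) (hk : k ∈ P.multKer z) :
    P.gradL (z + k) = 0 := by
  obtain ⟨l, hl, rfl⟩ := hk
  have hl' : ContinuousLinearMap.adjoint (P.jac z) l = 0 := hl
  have := P.gradL_add_inrL z l
  rw [hl', map_zero, add_zero] at this
  exact this.trans hz

/-- Under the second-order sufficiency condition the Hessian of the Lagrangian degenerates only
along the undetermined multipliers. -/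
lemma mem_multKer_of_hessL_eq_zero {z v : P.Pt} (hz : P.SecondOrderSufficient z)
    (hv : P.hessL z v = 0) : v ∈ P.multKer z := by
  have hJ : P.jac z v.fst = 0 := by rw [← hessL_snd, hv]; rfl
  have h1 : P.hessXX z v.fst + ContinuousLinearMap.adjoint (P.jac z) v.snd = 0 := by
    have h2 : P.hessL z (P.inlL v.fst) + P.hessL z (P.inrL v.snd) = 0 := by
      rw [← map_add, inlL_add_inrL, hv]
    have h3 := congrArg WithLp.fst h2
    rwa [WithLp.add_fst, hessL_inlL_fst, hessL_inrL, inlL_fst] at h3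
  have hy : v.fst = 0 := by
    by_contra hne
    have h2 := hz _ hJ hne
    -- Pairing with `v.fst` removes the multiplier term, since `⟨y, Jᵀ μ⟩ = ⟨J y, μ⟩ = 0`.
    have h3 := congrArg (fun t => inner ℝ v.fst t) h1
    simp only [inner_add_right, ContinuousLinearMap.adjoint_inner_right, hJ, inner_zero_left,
      inner_zero_right, add_zero] at h3
    exact h2.ne' h3
  rw [hy, map_zero, zero_add] at h1
  refine ⟨v.snd, h1, ?_⟩
  have := P.inlL_add_inrL v
  rwa [hy, map_zero, zero_add] at this

lemma existsUnique_isLMSequence (z₀ : P.Pt) : ∃! z : ℕ → P.Pt, P.IsLMSequence z₀ z := by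
  choose s hs hu using existsUnique_isLMStep P.gradL
  refine ⟨fun k => s^[k] z₀, ⟨rfl, fun k => ?_⟩, fun y hy => ?_⟩
  · have := hs (s^[k] z₀)
    rwa [← Function.iterate_succ_apply' s k z₀] at this
  · funext k
    induction k with
    | zero => exact hy.1
    | succ k ih =>
      rw [Function.iterate_succ_apply', ← ih]
      exact hu _ _ (hy.2 k)

end Problem

end ApproxSNF

end

theorem mainTheorem6 (P : ApproxSNF.Problem) (zs : P.Pt)
    (hfirst : P.FirstOrder zs) (hsecond : P.SecondOrderSufficient zs) :
    ∃ r > (0 : ℝ), ∃ C > (0 : ℝ), ∀ z₀ : P.Pt, ‖z₀ - zs‖ < r →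
      (∃! z : ℕ → P.Pt, P.IsLMSequence z₀ z) ∧
      ∀ z : ℕ → P.Pt, P.IsLMSequence z₀ z →
        ∃ zh : P.Pt, P.gradL zh = 0 ∧
          Filter.Tendsto z Filter.atTop (nhds zh) ∧
          (∀ k, ‖z (k + 1) - zh‖ ≤ C * ‖z k - zh‖ ^ 2) ∧
          (∀ k, Metric.infDist (z (k + 1)) {w | P.gradL w = 0}
            ≤ C * Metric.infDist (z k) {w | P.gradL w = 0} ^ 2) := by
  obtain ⟨r, hr, C, hC, h⟩ := ApproxSNF.exists_quadratic_convergence (P.contDiff_gradL (n := 2))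
    zs (P.multKer zs) (fun _ hk => P.gradL_add_of_mem_multKer hfirst hk)
    (fun _ hv => P.mem_multKer_of_hessL_eq_zero hsecond hv)
  refine ⟨r, hr, C, hC, fun z₀ hz₀ => ⟨P.existsUnique_isLMSequence z₀, fun z hz => ?_⟩⟩
  exact h z (hz.1 ▸ hz₀) hz.2
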